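/- For each $N\ge 1$ let $X^N_1,X^N_2,\dots$ be i.i.d. real random variables on some probability space (which may depend on $N$), with mean $\mu_N=\mathbb E[X^N_1]$, variance $\sigma_N^2$, moment generating function $M_N(\theta)=\mathbb E[e^{\theta X^N_1}]$ with derivatives $M_N^{(i)}$, and walk $S^N_m=\sum_{k=1}^m X^N_k$. Say that the family $(X^N)_{N\ge1}$ satisfies the assumption with parameters $(C_M,c_\mu,\sigma_*^2,\theta_1)\in\mathbb R_{>0}^4$ if (i) there is $\theta_0>\theta_1$ such that every $M_N$ is finite on $(-\theta_0,\theta_0)$, and $|M_N^{(i)}(\theta)|\le C_M$ for all $N\ge 1$, $0\le i\le 3$ and $\theta\in[-\theta_1,\theta_1]$; (ii) $\sigma_N^2\ge\sigma_*^2$ for all $N\ge1$; (iii) $\mu_N\le 0$ for all $N\ge1$, and $\mu_N\ge -c_\mu(\log N)^{-3}$ for all $N\ge 2$. Then for each compact set $\mathcal K\subset\mathbb R_{>0}^4$ there exist finite constants $C_{0,\mathcal K}$ and $N_{0,\mathcal K}$ such that, for every family $(X^N)_{N\ge1}$ satisfying the assumption with some parameters $(C_M,c_\mu,\sigma_*^2,\theta_1)\in\mathcal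 K$, every integer $N\ge N_{0,\mathcal K}$ and every real $x\ge(\log N)^2$, $$\mathbb P\Big(\max_{1\le m\le N}S^N_m\le x\Big)\le C_{0,\mathcal K}\,x\,(\log N)\,\bigl(|\mu_N|\vee N^{-1/2}\bigr).$$ -/

import Mathlib

open MeasureTheory ProbabilityTheory

universe u

/-- The random walk `S_m = X_1 + ⋯ + X_m`. Steps are indexed from `0`, so `X i` is the step
with number `i + 1`. -/
noncomputable def walk {Ω : Type u} (X : ℕ → Ω → ℝ) (m : ℕ) (ω : Ω) : ℝ :=
  ∑ i ∈ Finset.range m, X i ω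

/-- The running maximum `max_{1 ≤ m ≤ N} S_m`. -/
noncomputable def runningMax {Ω : Type u} (X : ℕ → Ω → ℝ) (N : ℕ+) (ω : Ω) : ℝ :=
  (Finset.Icc 1 (N : ℕ)).sup' (Finset.nonempty_Icc.2 N.pos) (fun m => walk X m ω)

/-- `X` is a sequence of real random variables on `(Ω, P)` that are independent and
identically distributed. -/
structure IsIIDSequence {Ω : Type u} [MeasurableSpace Ω] (P : Measure Ω) (X : ℕ → Ω → ℝ) :
    Prop where
  measurable : ∀ i, Measurable (X i)
  indep : iIndepFun X P
  identDistrib : ∀ i, IdentDistrib (X i) (X 0) P P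

/-- The assumption, with parameters `(CM, cμ, σsq, θ₁)`, on a family indexed by `N ≥ 1` of
i.i.d. step sequences `(X^N_i)_{i ≥ 1}`, the `N`-th living on its own probability space
`(Ω N, P N)`. Here `σsq` stands for `σ_*²`. (Non-degeneracy of the steps follows from `variance_lower`
for `σsq > 0`, and `E[(X^N_1)²] ≥ Var(X^N_1)` always holds.) -/
structure SmallDriftAssumption (CM cμ σsq θ₁ : ℝ)
    (Ω : ℕ+ → Type u) [∀ N, MeasurableSpace (Ω N)] (P : ∀ N, Measure (Ω N))
    (X : ∀ N, ℕ → Ω N → ℝ) : Prop where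
  iid : ∀ N, IsIIDSequence (P N) (X N)
  /-- The moment generating functions are finite on an open interval `(-θ₀, θ₀)` containing
  `[-θ₁, θ₁]`, with `θ₀` not depending on `N`. -/
  mgf_finite : ∃ θ₀ : ℝ, θ₁ < θ₀ ∧ ∀ N, ∀ θ ∈ Set.Ioo (-θ₀) θ₀,
    Integrable (fun ω => Real.exp (θ * X N 0 ω)) (P N)
  /-- The derivatives of order `0, 1, 2, 3` of the moment generating functions are bounded by
  `CM` on `[-θ₁, θ₁]`. -/
  mgf_bound : ∀ N, ∀ i ≤ 3, ∀ θ ∈ Set.Icc (-θ₁) θ₁,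
    |iteratedDeriv i (mgf (X N 0) (P N)) θ| ≤ CM
  variance_lower : ∀ N, σsq ≤ Var[X N 0; P N]
  mean_nonpos : ∀ N, ∫ ω, X N 0 ω ∂(P N) ≤ 0
  /-- For `N = 1` the lower bound `-cμ (log N)⁻³` is `-∞`, that is, no condition. -/
  mean_lower : ∀ N : ℕ+, 2 ≤ N →
    -cμ * (Real.log (N : ℝ)) ^ (-3 : ℤ) ≤ ∫ ω, X N 0 ω ∂(P N)

/-! Let `p k` be the probability that the walk `S` stays below `x` up to time `k`, and estimate the
mean of `x - S_k + L` on that event from both sides.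

From below: the negative part of `S_k`, truncated at `α √k`, and the indicator of the event both
decrease in every step, so Harris' inequality bounds the mean below by the product of their
expectations. A fourth moment argument shows that the truncated negative part has mean at least `c
√k`; a nonpositive drift only helps.

From above: up to drift, `x - S_k` is a martingale. Stopped at the crossing of `x`, it gives at most
`x + L + |μ| ∑_{j<k} p j + k δ`, where `δ` bounds the mean excess of a step over `L`. With `L = log
N / θ` the exponential moment makes `N δ` bounded.

The two sides give `c √k p k ≤ x + L + |μ| ∑_{j<k} p j + k δ`. By induction the earlier `p j` are
`O(1/√j)` and sum to `O(√k)`, so the drift term is absorbed as long as `|μ| √k ≤ c/4`. Hence `p n =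
O((x + log N) / √n)` for `n` of order `(|μ| ∨ N^{-1/2})⁻²`, with `n ≤ N`; survival up to `N` implies
survival up to `n`, and `x + log N = O(x log N)`. -/

/-! ### Association inequalities -/

/-- **Chebyshev's association inequality**: two bounded antitone functions of one real random
variable are nonnegatively correlated. -/
theorem integral_mul_integral_le_of_antitone (μ : Measure ℝ) [IsProbabilityMeasure μ]
    {f g : ℝ → ℝ} (hf : Antitone f) (hg : Antitone g) {A B : ℝ}
    (hfA : ∀ x, |f x| ≤ A) (hgB : ∀ x, |g x| ≤ B) :
    (∫ x, f x ∂μ) * (∫ x, g x ∂μ) ≤ ∫ x, f x * g x ∂μ := by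
  have hfi : Integrable f μ := .of_bound hf.measurable.aestronglyMeasurable A (.of_forall hfA)
  have hgi : Integrable g μ := .of_bound hg.measurable.aestronglyMeasurable B (.of_forall hgB)
  have hfg : Integrable (fun x => f x * g x) μ :=
    hgi.bdd_mul hf.measurable.aestronglyMeasurable (.of_forall hfA)
  -- The double integral equals `2 (∫ f g - ∫ f ∫ g)`; its integrand is nonnegative because `f` and
  -- `g` vary in the same direction.
  have key : 0 ≤ ∫ x, ∫ y, (f x - f y) * (g x - g y) ∂μ ∂μ := by
    refine integral_nonneg fun x => integral_nonneg fun y => ?_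
    rcases le_total x y with h | h
    · exact mul_nonneg (sub_nonneg.2 (hf h)) (sub_nonneg.2 (hg h))
    · exact mul_nonneg_of_nonpos_of_nonpos (sub_nonpos.2 (hf h)) (sub_nonpos.2 (hg h))
  have inner (x : ℝ) : ∫ y, (f x - f y) * (g x - g y) ∂μ =
      f x * g x - f x * (∫ y, g y ∂μ) - (∫ y, f y ∂μ) * g x + ∫ y, f y * g y ∂μ := by
    have : (fun y => (f x - f y) * (g x - g y)) =
        fun y => f x * g x - f x * g y - f y * g x + f y * g y := by
      ext y; ring
    have i1 : Integrable (fun y => f x * g x - f x * g y) μ :=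
      (integrable_const _).sub (hgi.const_mul _)
    have i2 : Integrable (fun y => f x * g x - f x * g y - f y * g x) μ :=
      i1.sub (hfi.mul_const _)
    rw [this, integral_add i2 hfg, integral_sub i1 (hfi.mul_const _),
      integral_sub (integrable_const _) (hgi.const_mul _)]
    simp [integral_const_mul, integral_mul_const]
  simp_rw [inner] at key
  have i1 : Integrable (fun x => f x * g x - f x * ∫ y, g y ∂μ) μ := hfg.sub (hfi.mul_const _)
  have i2 : Integrable (fun x => f x * g x - f x * (∫ y, g y ∂μ) - (∫ y, f y ∂μ) * g x) μ :=
    i1.sub (hgi.const_mul _)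
  rw [integral_add i2 (integrable_const _), integral_sub i1 (hgi.const_mul _),
    integral_sub hfg (hfi.mul_const _), integral_const_mul, integral_mul_const] at key
  simp only [integral_const, probReal_univ, one_smul] at key
  linarith

/-- **Harris' inequality**: bounded antitone functions of finitely many independent real random
variables are nonnegatively correlated. -/
theorem integral_mul_integral_le_of_antitone_pi {n : ℕ} (μ : Fin n → Measure ℝ)
    [∀ i, IsProbabilityMeasure (μ i)] {f g : (Fin n → ℝ) → ℝ} (hf : Antitone f) (hg : Antitone g)
    (hfm : Measurable f) (hgm : Measurable g) {A B : ℝ}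
    (hfA : ∀ x, |f x| ≤ A) (hgB : ∀ x, |g x| ≤ B) :
    (∫ x, f x ∂(Measure.pi μ)) * (∫ x, g x ∂(Measure.pi μ)) ≤
      ∫ x, f x * g x ∂(Measure.pi μ) := by
  induction n with
  | zero =>
    have (h : (Fin 0 → ℝ) → ℝ) : ∫ x, h x ∂(Measure.pi μ) = h default := by
      rw [Measure.pi_of_empty μ default, integral_dirac]
    simp [this]
  | succ n ih =>
    let ν : Fin n → Measure ℝ := fun j => μ (Fin.succAbove 0 j)
    have hmp := (measurePreserving_piFinSuccAbove μ 0).symm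
    let e : ℝ → (Fin n → ℝ) → Fin (n + 1) → ℝ :=
      fun a z => (MeasurableEquiv.piFinSuccAbove (fun _ => ℝ) 0).symm (a, z)
    have hem : Measurable (Function.uncurry e) :=
      (MeasurableEquiv.piFinSuccAbove (fun _ : Fin (n + 1) => ℝ) 0).symm.measurable
    have he : ∀ a b z w, a ≤ b → z ≤ w → e a z ≤ e b w := by
      intro a b z w hab hzw i
      simp only [e, MeasurableEquiv.piFinSuccAbove_symm_apply, Fin.insertNthEquiv_apply]
      refine Fin.cases ?_ (fun j => ?_) i
      · simpa using hab
      · simpa using hzw j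
    have bdd {h : (Fin (n + 1) → ℝ) → ℝ} (hm : Measurable h) {C : ℝ} (hC : ∀ x, |h x| ≤ C) (a : ℝ) :
        Integrable (fun z => h (e a z)) (Measure.pi ν) :=
      .of_bound ((hm.comp (hem.comp measurable_prodMk_left)).aestronglyMeasurable) C
        (.of_forall fun z => hC _)
    have split {h : (Fin (n + 1) → ℝ) → ℝ} (hm : Measurable h) {C : ℝ} (hC : ∀ x, |h x| ≤ C) :
        ∫ x, h x ∂(Measure.pi μ) = ∫ a, ∫ z, h (e a z) ∂(Measure.pi ν) ∂(μ 0) := by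
      rw [← hmp.integral_comp (MeasurableEquiv.measurableEmbedding _) h]
      exact integral_prod (fun p : ℝ × (Fin n → ℝ) => h (e p.1 p.2))
        (.of_bound (hm.comp hem).aestronglyMeasurable C (.of_forall fun z => hC _))
    have bound {h : (Fin (n + 1) → ℝ) → ℝ} {C : ℝ} (hC : ∀ x, |h x| ≤ C) (a : ℝ) :
        |∫ z, h (e a z) ∂(Measure.pi ν)| ≤ C := by
      simpa using norm_integral_le_of_norm_le_const (μ := Measure.pi ν) (f := fun z => h (e a z))
        (.of_forall fun z => hC (e a z))
    have anti {h : (Fin (n + 1) → ℝ) → ℝ} (hh : Antitone h) (hm : Measurable h) {C : ℝ}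
        (hC : ∀ x, |h x| ≤ C) : Antitone fun a => ∫ z, h (e a z) ∂(Measure.pi ν) :=
      fun a b hab => integral_mono (bdd hm hC b) (bdd hm hC a)
        fun z => hh (he a b z z hab le_rfl)
    have hfgB : ∀ x, |f x * g x| ≤ A * B := fun x => by
      rw [abs_mul]
      exact mul_le_mul (hfA x) (hgB x) (abs_nonneg _) ((abs_nonneg _).trans (hfA x))
    have hfgm : Measurable fun x => f x * g x := hfm.mul hgm
    -- Condition on the first coordinate: the partial integrals are antitone in it, so the
    -- one-variable inequality applies to them, and the induction hypothesis handles each slice.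
    rw [split hfm hfA, split hgm hgB, split hfgm hfgB]
    refine (integral_mul_integral_le_of_antitone (μ 0) (anti hf hfm hfA) (anti hg hgm hgB)
      (bound hfA) (bound hgB)).trans ?_
    refine integral_mono ?_ ?_ fun a => ?_
    · have h1 := anti hf hfm hfA
      have h2 := anti hg hgm hgB
      exact .of_bound (h1.measurable.mul h2.measurable).aestronglyMeasurable (A * B)
        (.of_forall fun a => by
          rw [Real.norm_eq_abs, abs_mul]
          exact mul_le_mul (bound hfA a) (bound hgB a) (abs_nonneg _)
            ((abs_nonneg _).trans (bound hfA a)))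
    · refine .of_bound ?_ (A * B) (.of_forall fun a => bound hfgB a)
      exact (((hfm.mul hgm).comp hem).stronglyMeasurable.integral_prod_right'
        (ν := Measure.pi ν)).aestronglyMeasurable
    · exact ih ν (fun z w h => hf (he a a z w le_rfl h)) (fun z w h => hg (he a a z w le_rfl h))
        (hfm.comp (hem.comp measurable_prodMk_left)) (hgm.comp (hem.comp measurable_prodMk_left))
        (fun _ => hfA _) (fun _ => hgB _)

/-- Harris' inequality for the first `n` terms of an independent sequence. -/
theorem integral_mul_integral_le_of_iIndepFun {Ω : Type*} [MeasurableSpace Ω] {P : Measure Ω}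
    [IsProbabilityMeasure P] {X : ℕ → Ω → ℝ} (hX : ∀ i, Measurable (X i)) (hind : iIndepFun X P)
    {n : ℕ} {f g : (Fin n → ℝ) → ℝ} (hf : Antitone f) (hg : Antitone g)
    (hfm : Measurable f) (hgm : Measurable g) {A B : ℝ}
    (hfA : ∀ x, |f x| ≤ A) (hgB : ∀ x, |g x| ≤ B) :
    (∫ ω, f (fun i => X i ω) ∂P) * (∫ ω, g (fun i => X i ω) ∂P) ≤
      ∫ ω, f (fun i => X i ω) * g (fun i => X i ω) ∂P := by
  have hind' : iIndepFun (fun i : Fin n => X i) P := hind.precomp Fin.val_injective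
  have hmap := (iIndepFun_iff_map_fun_eq_pi_map fun i : Fin n => (hX i).aemeasurable).1 hind'
  have hm : Measurable fun ω (i : Fin n) => X i ω := measurable_pi_lambda _ fun i => hX i
  have (i : Fin n) : IsProbabilityMeasure (P.map (X i)) :=
    Measure.isProbabilityMeasure_map (hX i).aemeasurable
  have tr {h : (Fin n → ℝ) → ℝ} (hh : Measurable h) : ∫ ω, h (fun i => X i ω) ∂P =
      ∫ x, h x ∂(Measure.pi fun i : Fin n => P.map (X i)) := by
    rw [← hmap, integral_map hm.aemeasurable hh.aestronglyMeasurable]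
  have hfgm : Measurable fun x => f x * g x := hfm.mul hgm
  rw [tr hfm, tr hgm, tr hfgm]
  exact integral_mul_integral_le_of_antitone_pi _ hf hg hfm hgm hfA hgB

/-! ### Moments of centred walks -/

theorem MeasureTheory.MemLp.integrable_pow_of_le {Ω : Type*} [MeasurableSpace Ω] {P : Measure Ω}
    [IsProbabilityMeasure P] {f : Ω → ℝ} {n : ℕ} (hf : MemLp f n P) {k : ℕ} (hk : k ≤ n) :
    Integrable (fun ω => f ω ^ k) P := by
  have h : MemLp f k P := hf.mono_exponent (by exact_mod_cast hk)
  exact h.integrable_norm_pow'.mono' (h.aestronglyMeasurable.pow k)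
    (.of_forall fun ω => by simp [norm_pow])

theorem ProbabilityTheory.IndepFun.integral_pow_mul_pow {Ω : Type*} [MeasurableSpace Ω]
    {P : Measure Ω} {S Y : Ω → ℝ} (h : IndepFun S Y P) (hS : Measurable S) (hY : Measurable Y)
    (i j : ℕ) : ∫ ω, S ω ^ i * Y ω ^ j ∂P = (∫ ω, S ω ^ i ∂P) * ∫ ω, Y ω ^ j ∂P :=
  (h.comp (measurable_id.pow_const i) (measurable_id.pow_const j)).integral_fun_mul_eq_mul_integral
    (hS.pow_const i).aestronglyMeasurable (hY.pow_const j).aestronglyMeasurable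

theorem ProbabilityTheory.IndepFun.integrable_pow_mul_pow {Ω : Type*} [MeasurableSpace Ω]
    {P : Measure Ω} [IsProbabilityMeasure P] {S Y : Ω → ℝ} (h : IndepFun S Y P) {n : ℕ}
    (hS : MemLp S n P) (hY : MemLp Y n P) {i j : ℕ} (hi : i ≤ n) (hj : j ≤ n) :
    Integrable (fun ω => S ω ^ i * Y ω ^ j) P :=
  (h.comp (measurable_id.pow_const i) (measurable_id.pow_const j)).integrable_mul
    (hS.integrable_pow_of_le hi) (hY.integrable_pow_of_le hj)

theorem walk_succ {Ω : Type*} (X : ℕ → Ω → ℝ) (n : ℕ) (ω : Ω) :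
    walk X (n + 1) ω = walk X n ω + X n ω :=
  Finset.sum_range_succ _ _

theorem measurable_walk {Ω : Type*} [MeasurableSpace Ω] {X : ℕ → Ω → ℝ}
    (hX : ∀ i, Measurable (X i)) (n : ℕ) : Measurable (walk X n) :=
  Finset.measurable_fun_sum _ fun i _ => hX i

theorem indepFun_walk {Ω : Type*} [MeasurableSpace Ω] {P : Measure Ω} {X : ℕ → Ω → ℝ}
    (hX : ∀ i, Measurable (X i)) (hind : iIndepFun X P) (n : ℕ) :
    IndepFun (walk X n) (X n) P := by
  have := hind.indepFun_sum_range_succ hX n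
  rwa [show ∑ j ∈ Finset.range n, X j = walk X n from
    funext fun ω => by simp [walk, Finset.sum_apply]] at this

theorem memLp_walk {Ω : Type*} [MeasurableSpace Ω] {P : Measure Ω} {X : ℕ → Ω → ℝ} {p : ENNReal}
    (hX : ∀ i, MemLp (X i) p P) (n : ℕ) : MemLp (walk X n) p P :=
  memLp_finsetSum _ fun i _ => hX i

theorem integral_walk_eq_zero {Ω : Type*} [MeasurableSpace Ω] {P : Measure Ω} [IsProbabilityMeasure P]
    {Y : ℕ → Ω → ℝ} (hL : ∀ i, MemLp (Y i) 4 P)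
    (hmean : ∀ i, ∫ ω, Y i ω ∂P = 0)
    (n : ℕ) : ∫ ω, walk Y n ω ∂P = 0 := by
  simp only [walk]
  rw [integral_finsetSum _ fun i _ => (hL i).integrable (by norm_num)]
  simp [hmean]

theorem integral_walk_sq {Ω : Type*} [MeasurableSpace Ω] {P : Measure Ω} [IsProbabilityMeasure P]
    {Y : ℕ → Ω → ℝ} (hY : ∀ i, Measurable (Y i)) (hind : iIndepFun Y P) (hL : ∀ i, MemLp (Y i) 4 P)
    (hmean : ∀ i, ∫ ω, Y i ω ∂P = 0) {v : ℝ} (hv : ∀ i, ∫ ω, Y i ω ^ 2 ∂P = v)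
    (n : ℕ) : ∫ ω, walk Y n ω ^ 2 ∂P = n * v := by
  induction n with
  | zero => simp [walk]
  | succ n ih =>
    have hi := indepFun_walk hY hind n
    have hW : MemLp (walk Y n) (4 : ℕ) P := memLp_walk hL n
    have hYn : MemLp (Y n) (4 : ℕ) P := hL n
    have e : (fun ω => walk Y (n + 1) ω ^ 2) = fun ω =>
        walk Y n ω ^ 2 + 2 * (walk Y n ω ^ 1 * Y n ω ^ 1) + Y n ω ^ 2 := by
      ext ω; rw [walk_succ]; ring
    have i1 := hW.integrable_pow_of_le (k := 2) (by norm_num)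
    have i2 := (hi.integrable_pow_mul_pow hW hYn (i := 1) (j := 1) (by norm_num)
      (by norm_num)).const_mul 2
    have i3 := hYn.integrable_pow_of_le (k := 2) (by norm_num)
    have i12 : Integrable (fun ω => walk Y n ω ^ 2 + 2 * (walk Y n ω ^ 1 * Y n ω ^ 1)) P :=
      i1.add i2
    rw [e, integral_add i12 i3, integral_add i1 i2, integral_const_mul,
      hi.integral_pow_mul_pow (measurable_walk hY n) (hY n), ih, hv]
    simp [hmean]
    ring

/-- In the expansion of the fourth power the terms with a first power of the walk or of the new step
vanish. The increment is thus at most `6 n v² + κ ≤ 3 κ (2 n + 1)`. -/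
theorem integral_walk_pow_four_le {Ω : Type*} [MeasurableSpace Ω] {P : Measure Ω}
    [IsProbabilityMeasure P]
    {Y : ℕ → Ω → ℝ} (hY : ∀ i, Measurable (Y i)) (hind : iIndepFun Y P) (hL : ∀ i, MemLp (Y i) 4 P)
    (hmean : ∀ i, ∫ ω, Y i ω ∂P = 0) {v : ℝ} (hv : ∀ i, ∫ ω, Y i ω ^ 2 ∂P = v)
    {κ : ℝ} (hκ : ∀ i, ∫ ω, Y i ω ^ 4 ∂P ≤ κ) (hvκ : v ^ 2 ≤ κ) (n : ℕ) :
    ∫ ω, walk Y n ω ^ 4 ∂P ≤ 3 * κ * n ^ 2 := by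
  induction n with
  | zero => simp [walk]
  | succ n ih =>
    have hi := indepFun_walk hY hind n
    have hW : MemLp (walk Y n) (4 : ℕ) P := memLp_walk hL n
    have hYn : MemLp (Y n) (4 : ℕ) P := hL n
    have e : (fun ω => walk Y (n + 1) ω ^ 4) = fun ω =>
        walk Y n ω ^ 4 + 4 * (walk Y n ω ^ 3 * Y n ω ^ 1) + 6 * (walk Y n ω ^ 2 * Y n ω ^ 2)
          + 4 * (walk Y n ω ^ 1 * Y n ω ^ 3) + Y n ω ^ 4 := by
      ext ω; rw [walk_succ]; ring
    have i1 := hW.integrable_pow_of_le (k := 4) le_rfl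
    have i2 := (hi.integrable_pow_mul_pow hW hYn (i := 3) (j := 1) (by norm_num)
      (by norm_num)).const_mul 4
    have i3 := (hi.integrable_pow_mul_pow hW hYn (i := 2) (j := 2) (by norm_num)
      (by norm_num)).const_mul 6
    have i4 := (hi.integrable_pow_mul_pow hW hYn (i := 1) (j := 3) (by norm_num)
      (by norm_num)).const_mul 4
    have i5 := hYn.integrable_pow_of_le (k := 4) le_rfl
    have hm := measurable_walk hY n
    have i12 : Integrable (fun ω => walk Y n ω ^ 4 + 4 * (walk Y n ω ^ 3 * Y n ω ^ 1)) P :=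
      i1.add i2
    have i13 : Integrable (fun ω => walk Y n ω ^ 4 + 4 * (walk Y n ω ^ 3 * Y n ω ^ 1)
        + 6 * (walk Y n ω ^ 2 * Y n ω ^ 2)) P := i12.add i3
    have i14 : Integrable (fun ω => walk Y n ω ^ 4 + 4 * (walk Y n ω ^ 3 * Y n ω ^ 1)
        + 6 * (walk Y n ω ^ 2 * Y n ω ^ 2) + 4 * (walk Y n ω ^ 1 * Y n ω ^ 3)) P := i13.add i4
    rw [e, integral_add i14 i5, integral_add i13 i4, integral_add i12 i3, integral_add i1 i2, integral_const_mul, integral_const_mul,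
      integral_const_mul, hi.integral_pow_mul_pow hm (hY n), hi.integral_pow_mul_pow hm (hY n),
      hi.integral_pow_mul_pow hm (hY n), integral_walk_sq hY hind hL hmean hv, hv]
    simp only [pow_one, hmean, integral_walk_eq_zero hL hmean]
    have := hκ n
    have hn : (n : ℝ) * v ^ 2 ≤ n * κ := by gcongr
    have hκ0 : 0 ≤ κ := (sq_nonneg v).trans hvκ
    push_cast
    nlinarith

/-! ### The truncated negative part -/

/-- A polynomial minorant, so that only moments are needed: the linear term has mean zero for a
centred walk, the square supplies the gain, and the fourth power keeps the polynomial below the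
truncation. Scaling reduces to `a = 1`. -/
theorem min_negPart_ge {a : ℝ} (ha : 0 < a) (s : ℝ) :
    -s / 2 + s ^ 2 / (4 * a) - s ^ 4 / (8 * a ^ 3) ≤ min (max (-s) 0) a := by
  obtain ⟨t, rfl⟩ : ∃ t, s = a * t := ⟨s / a, by field_simp⟩
  have e : -(a * t) / 2 + (a * t) ^ 2 / (4 * a) - (a * t) ^ 4 / (8 * a ^ 3) =
      a * (-t / 2 + t ^ 2 / 4 - t ^ 4 / 8) := by
    field_simp
  rw [e, show min (max (-(a * t)) 0) a = a * min (max (-t) 0) 1 by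
    rw [mul_min_of_nonneg _ _ ha.le, mul_max_of_nonneg _ _ ha.le]; simp]
  refine mul_le_mul_of_nonneg_left ?_ ha.le
  refine le_min ?_ ?_
  · rcases le_total 0 t with h | h
    · refine le_trans ?_ (le_max_right _ _)
      nlinarith [sq_nonneg (t ^ 2 - 1), sq_nonneg (t - 1), mul_nonneg h (sq_nonneg (t - 1)),
        mul_nonneg h (sq_nonneg t), sq_nonneg t]
    · refine le_trans ?_ (le_max_left _ _)
      nlinarith [sq_nonneg (t ^ 2 - 1), sq_nonneg (t + 1),
        mul_nonneg (neg_nonneg.2 h) (sq_nonneg (t + 1)),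
        mul_nonneg (neg_nonneg.2 h) (sq_nonneg t), sq_nonneg t]
  · nlinarith [sq_nonneg (t ^ 2 - 1), sq_nonneg (t + 1)]

theorem integral_min_negPart_walk_ge {Ω : Type*} [MeasurableSpace Ω] {P : Measure Ω}
    [IsProbabilityMeasure P]
    {Y : ℕ → Ω → ℝ} (hY : ∀ i, Measurable (Y i)) (hind : iIndepFun Y P) (hL : ∀ i, MemLp (Y i) 4 P)
    (hmean : ∀ i, ∫ ω, Y i ω ∂P = 0) {v : ℝ} (hv : ∀ i, ∫ ω, Y i ω ^ 2 ∂P = v)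
    {κ : ℝ} (hκ : ∀ i, ∫ ω, Y i ω ^ 4 ∂P ≤ κ) (hvκ : v ^ 2 ≤ κ)
    {α : ℝ} (hα : 0 < α) {n : ℕ} (hn : 0 < n) :
    √n * (v / (4 * α) - 3 * κ / (8 * α ^ 3)) ≤
      ∫ ω, min (max (-walk Y n ω) 0) (α * √n) ∂P := by
  have hs : 0 < √(n : ℝ) := Real.sqrt_pos.2 (by exact_mod_cast hn)
  have hss : √(n : ℝ) ^ 2 = n := Real.sq_sqrt (by positivity)
  set a := α * √n with ha
  have ha0 : 0 < a := by positivity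
  have hW : MemLp (walk Y n) (4 : ℕ) P := memLp_walk hL n
  have i1 : Integrable (fun ω => -walk Y n ω / 2) P :=
    ((hW.integrable (by norm_num)).neg).div_const 2
  have i2 : Integrable (fun ω => walk Y n ω ^ 2 / (4 * a)) P :=
    (hW.integrable_pow_of_le (by norm_num)).div_const _
  have i3 : Integrable (fun ω => walk Y n ω ^ 4 / (8 * a ^ 3)) P :=
    (hW.integrable_pow_of_le le_rfl).div_const _
  have i12 : Integrable (fun ω => -walk Y n ω / 2 + walk Y n ω ^ 2 / (4 * a)) P := i1.add i2
  have im : Integrable (fun ω => min (max (-walk Y n ω) 0) a) P := by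
    refine .of_bound ((((measurable_walk hY n).neg.max measurable_const).min
      measurable_const).aestronglyMeasurable) a (.of_forall fun ω => ?_)
    rw [Real.norm_eq_abs, abs_of_nonneg (le_min (le_max_right _ _) ha0.le)]
    exact min_le_right _ _
  have key := integral_mono (i12.sub i3) im fun ω => min_negPart_ge ha0 (walk Y n ω)
  refine le_trans ?_ key
  simp only [Pi.sub_apply]
  rw [integral_sub i12 i3, integral_add i1 i2, integral_div, integral_div, integral_div,
    integral_neg, integral_walk_eq_zero hL hmean, integral_walk_sq hY hind hL hmean hv]
  have h4 := integral_walk_pow_four_le hY hind hL hmean hv hκ hvκ n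
  have h4' : (∫ ω, walk Y n ω ^ 4 ∂P) / (8 * a ^ 3) ≤ 3 * κ * n ^ 2 / (8 * a ^ 3) := by gcongr
  have e (s : ℝ) (hs : 0 < s) : s * (v / (4 * α) - 3 * κ / (8 * α ^ 3)) =
      s ^ 2 * v / (4 * (α * s)) - 3 * κ * (s ^ 2) ^ 2 / (8 * (α * s) ^ 3) := by
    field_simp
  have e' := e _ hs
  rw [hss, ← ha] at e'
  linarith

/-! ### Staying below a level: upper and lower estimates -/

/-- The event that the walk stays below `x` during the first `k` steps. -/
def belowUntil {Ω : Type*} (X : ℕ → Ω → ℝ) (x : ℝ) (k : ℕ) : Set Ω :=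
  {ω | ∀ m ≤ k, walk X m ω ≤ x}

theorem measurableSet_belowUntil {Ω : Type*} [MeasurableSpace Ω] {X : ℕ → Ω → ℝ}
    (hX : ∀ i, Measurable (X i)) (x : ℝ) (k : ℕ) : MeasurableSet (belowUntil X x k) := by
  simp only [belowUntil, Set.ofPred_forall]
  exact .iInter fun m => .iInter fun _ => measurableSet_le (measurable_walk hX m) measurable_const

/-- The `i`-th coordinate of a vector in `Fin k → ℝ`, extended by zero. -/
def coordOrZero (k i : ℕ) (z : Fin k → ℝ) : ℝ :=
  if h : i < k then z ⟨i, h⟩ else 0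

theorem measurable_coordOrZero (k i : ℕ) : Measurable (coordOrZero k i) := by
  unfold coordOrZero
  split_ifs
  · exact measurable_pi_apply _
  · exact measurable_const

theorem walk_coordOrZero_mono (k m : ℕ) : Monotone (walk (coordOrZero k) m) := by
  intro z w h
  refine Finset.sum_le_sum fun i _ => ?_
  unfold coordOrZero
  split_ifs
  · exact h _
  · exact le_rfl

/-- Up to time `k` the extension by zero is never seen. This presents functionals of the walk as
functions on `Fin k → ℝ`, the form that Harris' inequality and independence require. -/
theorem walk_coordOrZero {Ω : Type*} (X : ℕ → Ω → ℝ) {k m : ℕ} (hm : m ≤ k) (ω : Ω) :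
    walk (coordOrZero k) m (fun i => X i ω) = walk X m ω :=
  Finset.sum_congr rfl fun _ hi => dif_pos ((Finset.mem_range.1 hi).trans_le hm)

theorem coordOrZero_mem_belowUntil {Ω : Type*} (X : ℕ → Ω → ℝ) (x : ℝ) (k : ℕ) (ω : Ω) :
    (fun i : Fin k => X i ω) ∈ belowUntil (coordOrZero k) x k ↔ ω ∈ belowUntil X x k :=
  forall₂_congr fun m hm => by rw [walk_coordOrZero X hm]

theorem indicator_belowUntil_coordOrZero {Ω : Type*} (X : ℕ → Ω → ℝ) (x : ℝ) (k : ℕ) (ω : Ω) :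
    (belowUntil (coordOrZero k) x k).indicator 1 (fun i : Fin k => X i ω) =
      (belowUntil X x k).indicator (1 : Ω → ℝ) ω := by
  classical simp only [Set.indicator_apply, coordOrZero_mem_belowUntil, Pi.one_apply]

/-- The event up to time `k` depends on `X 0, …, X (k - 1)` only; with steps indexed from `0`, `X k`
is the next one. -/
theorem indepFun_indicator_belowUntil {Ω : Type*} [MeasurableSpace Ω] {P : Measure Ω}
    {X : ℕ → Ω → ℝ} (hX : ∀ i, Measurable (X i)) (hind : iIndepFun X P) (x : ℝ) (k : ℕ) :
    IndepFun ((belowUntil X x k).indicator (1 : Ω → ℝ)) (X k) P := by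
  have h := hind.indepFun_finset (Finset.range k) {k} (by simp) hX
  have hφ : Measurable fun (z : Finset.range k → ℝ) (i : Fin k) =>
      z ⟨i, Finset.mem_range.2 i.2⟩ := measurable_pi_lambda _ fun i => measurable_pi_apply _
  have hg : Measurable ((belowUntil (coordOrZero k) x k).indicator (1 : (Fin k → ℝ) → ℝ)) :=
    measurable_one.indicator (measurableSet_belowUntil (measurable_coordOrZero k) x k)
  have := h.comp (hg.comp hφ) (measurable_pi_apply (⟨k, by simp⟩ : ({k} : Finset ℕ)))
  have e : (fun ω => (belowUntil (coordOrZero k) x k).indicator 1 (fun i : Fin k => X i ω)) =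
      (belowUntil X x k).indicator (1 : Ω → ℝ) :=
    funext fun ω => indicator_belowUntil_coordOrZero X x k ω
  rw [← e]
  exact this

theorem integral_indicator_belowUntil_mul {Ω : Type*} [MeasurableSpace Ω] {P : Measure Ω}
    {X : ℕ → Ω → ℝ} (hX : ∀ i, Measurable (X i)) (hind : iIndepFun X P) (x : ℝ) (k : ℕ) :
    ∫ ω, (belowUntil X x k).indicator 1 ω * X k ω ∂P =
      P.real (belowUntil X x k) * ∫ ω, X k ω ∂P := by
  have hm := measurableSet_belowUntil hX x k
  rw [(indepFun_indicator_belowUntil hX hind x k).integral_fun_mul_eq_mul_integral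
    (measurable_one.indicator hm).aestronglyMeasurable (hX k).aestronglyMeasurable,
    integral_indicator_one hm]

/-- If the walk crosses at step `k + 1`, the left side vanishes and the last term makes up for a
jump larger than `L`, since `x - walk X k ω ≥ 0`. Otherwise the first two terms on the right already
equal the left side. -/
theorem indicator_belowUntil_succ_le {Ω : Type*} (X : ℕ → Ω → ℝ) (x : ℝ) {L : ℝ} (k : ℕ) (ω : Ω) :
    (belowUntil X x (k + 1)).indicator 1 ω * (x - walk X (k + 1) ω + L) ≤
      (belowUntil X x k).indicator 1 ω * (x - walk X k ω + L)
        - (belowUntil X x k).indicator 1 ω * X k ω + max (X k ω - L) 0 := by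
  have h1 := le_max_left (X k ω - L) 0
  have h2 := le_max_right (X k ω - L) 0
  have hs := walk_succ X k ω
  by_cases hk : ω ∈ belowUntil X x k
  · have hx : walk X k ω ≤ x := hk k le_rfl
    by_cases hk' : ω ∈ belowUntil X x (k + 1)
    · simp only [hk, hk', Set.indicator_of_mem, Pi.one_apply]
      linarith
    · simp only [hk, hk', Set.indicator_of_mem, Set.indicator_of_notMem, not_false_eq_true,
        Pi.one_apply]
      linarith
  · have hk' : ω ∉ belowUntil X x (k + 1) := fun h => hk fun m hm => h m (hm.trans k.le_succ)
    simpa only [hk, hk', Set.indicator_of_notMem, not_false_eq_true, zero_mul, zero_sub, neg_zero,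
      zero_add] using h2

theorem integrable_indicator_belowUntil_mul {Ω : Type*} [MeasurableSpace Ω] {P : Measure Ω}
    {X : ℕ → Ω → ℝ} (hX : ∀ i, Measurable (X i)) (x : ℝ) (k : ℕ) {f : Ω → ℝ}
    (hf : Integrable f P) : Integrable (fun ω => (belowUntil X x k).indicator 1 ω * f ω) P := by
  refine hf.bdd_mul (c := 1)
    (measurable_one.indicator (measurableSet_belowUntil hX x k)).aestronglyMeasurable
    (.of_forall fun ω => ?_)
  by_cases h : ω ∈ belowUntil X x k <;> simp [h]

/-- An upper bound for the expected distance to `x` on the event that the walk has not crossed `x`;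
the overshoot is controlled by the truncation level `L`. -/
theorem integral_indicator_belowUntil_le {Ω : Type*} [MeasurableSpace Ω] {P : Measure Ω}
    [IsProbabilityMeasure P] {X : ℕ → Ω → ℝ} (hX : ∀ i, Measurable (X i)) (hind : iIndepFun X P)
    (hint : ∀ i, Integrable (X i) P) {μ : ℝ} (hmean : ∀ i, ∫ ω, X i ω ∂P = μ) {x L δ : ℝ}
    (hx : 0 ≤ x) (hδ : ∀ i, ∫ ω, max (X i ω - L) 0 ∂P ≤ δ) (k : ℕ) :
    ∫ ω, (belowUntil X x k).indicator 1 ω * (x - walk X k ω + L) ∂P ≤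
      x + L - μ * (∑ j ∈ Finset.range k, P.real (belowUntil X x j)) + k * δ := by
  have hW (n : ℕ) : Integrable (fun ω => x - walk X n ω + L) P :=
    ((integrable_const x).sub (integrable_finsetSum _ fun i _ => hint i)).add (integrable_const L)
  induction k with
  | zero =>
    have : belowUntil X x 0 = Set.univ := Set.eq_univ_of_forall fun ω m hm => by
      rw [Nat.le_zero.1 hm]; simpa [walk] using hx
    simp [this, walk]
  | succ k ih =>
    have i1 := integrable_indicator_belowUntil_mul hX x k (hW k)
    have i2 := integrable_indicator_belowUntil_mul hX x k (hint k)
    have i3 : Integrable (fun ω => max (X k ω - L) 0) P :=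
      ((hint k).sub (integrable_const L)).sup (integrable_const 0)
    have i12 : Integrable (fun ω => (belowUntil X x k).indicator 1 ω * (x - walk X k ω + L)
      - (belowUntil X x k).indicator 1 ω * X k ω) P := i1.sub i2
    refine (integral_mono (integrable_indicator_belowUntil_mul hX x (k + 1) (hW (k + 1)))
      (i12.add i3) fun ω => indicator_belowUntil_succ_le X x k ω).trans ?_
    simp only [Pi.add_apply]
    rw [integral_add i12 i3, integral_sub i1 i2, integral_indicator_belowUntil_mul hX hind, hmean,
      Finset.sum_range_succ]
    have := hδ k
    push_cast
    linarith

/-- Harris' inequality separates the terminal value of the walk from the event that the walk stays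
below `x`. -/
theorem integral_min_negPart_walk_mul_le {Ω : Type*} [MeasurableSpace Ω] {P : Measure Ω}
    [IsProbabilityMeasure P] {X : ℕ → Ω → ℝ} (hX : ∀ i, Measurable (X i)) (hind : iIndepFun X P)
    (hint : ∀ i, Integrable (X i) P) {x L A : ℝ} (hx : 0 ≤ x) (hL : 0 ≤ L) (hA : 0 ≤ A) (k : ℕ) :
    (∫ ω, min (max (-walk X k ω) 0) A ∂P) * P.real (belowUntil X x k) ≤
      ∫ ω, (belowUntil X x k).indicator 1 ω * (x - walk X k ω + L) ∂P := by
  let f : (Fin k → ℝ) → ℝ := fun z => min (max (-walk (coordOrZero k) k z) 0) A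
  let g : (Fin k → ℝ) → ℝ := (belowUntil (coordOrZero k) x k).indicator 1
  have hf : Antitone f := fun z w h =>
    min_le_min_right _ (max_le_max_right _ (neg_le_neg (walk_coordOrZero_mono k k h)))
  have hg : Antitone g := by
    intro z w h
    refine Set.indicator_apply_le' (fun hw => ?_) fun _ =>
      Set.indicator_nonneg (fun _ _ => zero_le_one) _
    have hz : z ∈ belowUntil (coordOrZero k) x k := fun m hm =>
      (walk_coordOrZero_mono k m h).trans (hw m hm)
    simp [g, hz]
  have hfm : Measurable f :=
    ((measurable_walk (measurable_coordOrZero k) k).neg.max measurable_const).min measurable_const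
  have hgm : Measurable g :=
    measurable_one.indicator (measurableSet_belowUntil (measurable_coordOrZero k) x k)
  have hfA : ∀ z, |f z| ≤ A := fun z => by
    rw [abs_of_nonneg (le_min (le_max_right _ _) hA)]
    exact min_le_right _ _
  have hgB : ∀ z, |g z| ≤ 1 := fun z => by
    by_cases h : z ∈ belowUntil (coordOrZero k) x k <;> simp [g, h]
  have key := integral_mul_integral_le_of_iIndepFun hX hind hf hg hfm hgm hfA hgB
  simp only [f, g, walk_coordOrZero X le_rfl, indicator_belowUntil_coordOrZero] at key
  rw [integral_indicator_one (measurableSet_belowUntil hX x k)] at key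
  have hW : Integrable (walk X k) P := integrable_finsetSum _ fun i _ => hint i
  refine key.trans (integral_mono ?_ (integrable_indicator_belowUntil_mul hX x k
    (((integrable_const x).sub hW).add (integrable_const L))) fun ω => ?_)
  · simp_rw [mul_comm (min _ _)]
    exact integrable_indicator_belowUntil_mul hX x k
      ((hW.neg.sup (integrable_const 0)).inf (integrable_const A))
  · by_cases h : ω ∈ belowUntil X x k
    · have hxk : walk X k ω ≤ x := h k le_rfl
      simp only [h, Set.indicator_of_mem, Pi.one_apply, mul_one, one_mul]
      -- On the event both `-S_k` and `0` are at most `x - S_k + L`, because `x`, `L` and `x - S_k`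
      -- are nonnegative.
      exact (min_le_left _ _).trans (max_le (by linarith) (by linarith))
    · simp [h]

/-- The expected negative part of a walk with nonpositive drift, truncated at level `α √k`, is of
order `√k`. -/
theorem sqrt_mul_le_integral_min_negPart_walk {Ω : Type*} [MeasurableSpace Ω] {P : Measure Ω}
    [IsProbabilityMeasure P] {X : ℕ → Ω → ℝ} (hX : ∀ i, Measurable (X i)) (hind : iIndepFun X P)
    (hL : ∀ i, MemLp (X i) 4 P) {μ : ℝ} (hmean : ∀ i, ∫ ω, X i ω ∂P = μ) (hμ : μ ≤ 0) {v κ : ℝ}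
    (hv : ∀ i, ∫ ω, (X i ω - μ) ^ 2 ∂P = v) (hκ : ∀ i, ∫ ω, (X i ω - μ) ^ 4 ∂P ≤ κ)
    (hvκ : v ^ 2 ≤ κ) {α : ℝ} (hα : 0 < α) {k : ℕ} (hk : 0 < k) :
    √k * (v / (4 * α) - 3 * κ / (8 * α ^ 3)) ≤
      ∫ ω, min (max (-walk X k ω) 0) (α * √k) ∂P := by
  have hint : ∀ i, Integrable (X i) P := fun i => (hL i).integrable (by norm_num)
  have hY : ∀ i, Measurable fun ω => X i ω - μ := fun i => (hX i).sub_const μ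
  have hYind : iIndepFun (fun i ω => X i ω - μ) P :=
    hind.comp (fun _ y => y - μ) fun _ => measurable_id.sub_const μ
  have hYL : ∀ i, MemLp (fun ω => X i ω - μ) 4 P := fun i => (hL i).sub (memLp_const μ)
  have hY0 : ∀ i, ∫ ω, (X i ω - μ) ∂P = 0 := fun i => by
    rw [integral_sub (hint i) (integrable_const μ), hmean]
    simp
  refine (integral_min_negPart_walk_ge hY hYind hYL hY0 hv hκ hvκ hα hk).trans ?_
  have trunc {f : Ω → ℝ} (hf : Integrable f P) :
      Integrable (fun ω => min (max (-f ω) 0) (α * √k)) P :=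
    (hf.neg.sup (integrable_const 0)).inf (integrable_const _)
  refine integral_mono
    (trunc (integrable_finsetSum _ fun i _ => (hYL i).integrable (by norm_num)))
    (trunc (integrable_finsetSum _ fun i _ => hint i)) fun ω => ?_
  -- As `μ ≤ 0`, centring raises the walk and so lowers its negative part.
  refine min_le_min_right _ (max_le_max_right _ (neg_le_neg ?_))
  exact Finset.sum_le_sum fun i _ => by linarith

/-! ### Closing the recursion for the survival probabilities -/

theorem sum_range_le_of_sqrt_mul_le {p : ℕ → ℝ} {M : ℝ} (hM : 0 ≤ M) (hp : p 0 ≤ 1) {n : ℕ}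
    (h : ∀ k, 1 ≤ k → k ≤ n → √k * p k ≤ M) :
    ∑ j ∈ Finset.range (n + 1), p j ≤ 1 + 2 * M * √n := by
  induction n with
  | zero => simpa using hp
  | succ n ih =>
    rw [Finset.sum_range_succ]
    have h1 := ih fun k hk hkn => h k hk (hkn.trans n.le_succ)
    have h2 := h (n + 1) (by omega) le_rfl
    have ha : 0 ≤ √(n : ℝ) := Real.sqrt_nonneg _
    have hb : 0 < √((n + 1 : ℕ) : ℝ) := Real.sqrt_pos.2 (by positivity)
    have haa : √(n : ℝ) ^ 2 = n := Real.sq_sqrt (by positivity)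
    have hbb : √((n + 1 : ℕ) : ℝ) ^ 2 = n + 1 := by
      rw [Real.sq_sqrt (by positivity)]; push_cast; ring
    set a := √(n : ℝ)
    set b := √((n + 1 : ℕ) : ℝ)
    have h3 : p (n + 1) ≤ M / b := by rwa [le_div_iff₀' hb]
    -- Telescoping of `1 / √j`: since `b² - a² = 1`, one has `2 b (b - a) = 1 + (b - a)² ≥ 1`.
    have h4 : M / b ≤ M * (2 * (b - a)) := by
      rw [div_le_iff₀ hb, mul_assoc]
      refine le_mul_of_one_le_right hM ?_
      nlinarith [sq_nonneg (b - a)]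
    linarith

/-- A walk with drift of order `-1 / √n` stays below `x` for `n` steps with probability of order
`1 / √n`. -/
theorem sqrt_mul_measure_belowUntil_le {Ω : Type*} [MeasurableSpace Ω] {P : Measure Ω}
    [IsProbabilityMeasure P] {X : ℕ → Ω → ℝ} (hX : ∀ i, Measurable (X i)) (hind : iIndepFun X P)
    (hL : ∀ i, MemLp (X i) 4 P) {μ : ℝ} (hmean : ∀ i, ∫ ω, X i ω ∂P = μ) (hμ : μ ≤ 0) {v κ : ℝ}
    (hv : ∀ i, ∫ ω, (X i ω - μ) ^ 2 ∂P = v) (hκ : ∀ i, ∫ ω, (X i ω - μ) ^ 4 ∂P ≤ κ)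
    (hvκ : v ^ 2 ≤ κ) {α c : ℝ} (hα : 0 < α) (hc : 0 < c)
    (hcv : c ≤ v / (4 * α) - 3 * κ / (8 * α ^ 3)) {x l δ d : ℝ} (hx : 0 ≤ x) (hl : 0 ≤ l)
    (hδ : ∀ i, ∫ ω, max (X i ω - l) 0 ∂P ≤ δ) {n : ℕ} (hn : n * δ ≤ d)
    (hnμ : 4 * (|μ| * √n) ≤ c) {k : ℕ} (hk : 1 ≤ k) (hkn : k ≤ n) :
    √k * P.real (belowUntil X x k) ≤ 2 * (x + l + |μ| + d) / c := by
  have hδ0 : 0 ≤ δ := (integral_nonneg fun ω => le_max_right _ _).trans (hδ 0)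
  have hd0 : 0 ≤ d := le_trans (by positivity) hn
  have hint : ∀ i, Integrable (X i) P := fun i => (hL i).integrable (by norm_num)
  set R := x + l + |μ| + d with hR
  have hR0 : 0 ≤ R := by positivity
  induction k using Nat.strong_induction_on with
  | _ k ih =>
    obtain ⟨m, rfl⟩ : ∃ m, k = m + 1 := ⟨k - 1, by omega⟩
    have hsum := sum_range_le_of_sqrt_mul_le (p := fun j => P.real (belowUntil X x j)) (n := m)
      (M := 2 * R / c) (by positivity) measureReal_le_one
      fun j hj hjm => ih j (by omega) hj (by omega)
    have h1 := (mul_le_mul_of_nonneg_right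
      ((mul_le_mul_of_nonneg_left hcv (Real.sqrt_nonneg _)).trans
        (sqrt_mul_le_integral_min_negPart_walk hX hind hL hmean hμ hv hκ hvκ hα hk))
      measureReal_nonneg).trans
      ((integral_min_negPart_walk_mul_le hX hind hint hx hl (by positivity) (m + 1)).trans
      (integral_indicator_belowUntil_le hX hind hint hmean hx hδ (m + 1)))
    have h2 : ((m + 1 : ℕ) : ℝ) * δ ≤ d :=
      le_trans (mul_le_mul_of_nonneg_right (by exact_mod_cast hkn) hδ0) hn
    have h3 : -μ * ∑ j ∈ Finset.range (m + 1), P.real (belowUntil X x j) ≤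
        |μ| * (1 + 2 * (2 * R / c) * √m) := by
      rw [abs_of_nonpos hμ]
      exact mul_le_mul_of_nonneg_left hsum (by linarith)
    have h4 : |μ| * √m ≤ c / 4 := by
      have : √(m : ℝ) ≤ √n := Real.sqrt_le_sqrt (by exact_mod_cast (by omega : m ≤ n))
      have := mul_le_mul_of_nonneg_left this (abs_nonneg μ)
      linarith
    -- The drift contributes at most another `R` beyond the terms that make up `R`; this is the
    -- factor `2` in the claim, so the induction reproduces its own constant.
    have h5 : |μ| * (1 + 2 * (2 * R / c) * √m) ≤ |μ| + R := by
      have : 2 * (2 * R / c) * (|μ| * √m) ≤ 2 * (2 * R / c) * (c / 4) := by gcongr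
      have e : 2 * (2 * R / c) * (c / 4) = R := by field_simp; ring
      linarith
    rw [le_div_iff₀ hc]
    linarith

theorem belowUntil_anti {Ω : Type*} (X : ℕ → Ω → ℝ) (x : ℝ) : Antitone (belowUntil X x) :=
  fun _ _ h _ hω m hm => hω m (hm.trans h)

theorem setOf_runningMax_le_subset {Ω : Type*} (X : ℕ → Ω → ℝ) {x : ℝ} (hx : 0 ≤ x) (N : ℕ+) :
    {ω | runningMax X N ω ≤ x} ⊆ belowUntil X x N := by
  intro ω hω m hm
  rcases Nat.eq_zero_or_pos m with rfl | h
  · simpa [walk] using hx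
  · exact (Finset.le_sup' (fun m => walk X m ω) (Finset.mem_Icc.2 ⟨h, hm⟩)).trans hω

/-! ### Moment and overshoot bounds from exponential moments -/

section ExponentialMoments

variable {Ω : Type*} [MeasurableSpace Ω] {P : Measure Ω} {Y : Ω → ℝ} {θ C : ℝ}

theorem integral_abs_pow_le_of_mgf_le (hθ : 0 < θ) (hp : Integrable (fun ω => Real.exp (θ * Y ω)) P)
    (hm : Integrable (fun ω => Real.exp (-θ * Y ω)) P) (hpC : mgf Y P θ ≤ C)
    (hmC : mgf Y P (-θ) ≤ C) (k : ℕ) :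
    ∫ ω, |Y ω| ^ k ∂P ≤ 2 * C * k.factorial / θ ^ k := by
  have key : ∀ ω, |Y ω| ^ k ≤
      (k.factorial / θ ^ k) * (Real.exp (θ * Y ω) + Real.exp (-θ * Y ω)) := fun ω => by
    have h1 := Real.pow_div_factorial_le_exp _ (mul_nonneg hθ.le (abs_nonneg (Y ω))) k
    have h2 : Real.exp (θ * |Y ω|) ≤ Real.exp (θ * Y ω) + Real.exp (-θ * Y ω) := by
      rcases abs_choice (Y ω) with h | h <;> rw [h]
      · linarith [Real.exp_pos (-θ * Y ω)]
      · rw [mul_neg, ← neg_mul]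
        linarith [Real.exp_pos (θ * Y ω)]
    have h3 := h1.trans h2
    rw [div_le_iff₀ (by positivity), mul_pow] at h3
    rw [div_mul_eq_mul_div, le_div_iff₀ (by positivity)]
    linarith
  refine (integral_mono_of_nonneg (.of_forall fun ω => by positivity)
    ((hp.add hm).const_mul _) (.of_forall key)).trans ?_
  simp only [Pi.add_apply]
  rw [integral_const_mul, integral_add hp hm]
  calc _ ≤ (k.factorial / θ ^ k) * (C + C) :=
        mul_le_mul_of_nonneg_left (add_le_add hpC hmC) (by positivity)
    _ = _ := by ring

/-- Pointwise, `θ (y - l) ≤ exp (θ (y - l))`. The factor `exp (-(θ * l))` becomes `1 / N` at `l =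
log N / θ`. -/
theorem integral_max_sub_le_of_mgf_le (hθ : 0 < θ)
    (hp : Integrable (fun ω => Real.exp (θ * Y ω)) P) (hpC : mgf Y P θ ≤ C) (l : ℝ) :
    ∫ ω, max (Y ω - l) 0 ∂P ≤ Real.exp (-(θ * l)) * C / θ := by
  have key : ∀ ω, max (Y ω - l) 0 ≤ Real.exp (-(θ * l)) / θ * Real.exp (θ * Y ω) := fun ω => by
    rw [div_mul_eq_mul_div, ← Real.exp_add, le_div_iff₀ hθ]
    have h := Real.add_one_le_exp (-(θ * l) + θ * Y ω)
    have h' := Real.exp_pos (-(θ * l) + θ * Y ω)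
    rcases max_cases (Y ω - l) 0 with ⟨e, _⟩ | ⟨e, _⟩ <;> rw [e]
    · linarith
    · linarith
  refine (integral_mono_of_nonneg (.of_forall fun ω => le_max_right _ _)
    (hp.const_mul _) (.of_forall key)).trans ?_
  rw [integral_const_mul, div_mul_eq_mul_div]
  gcongr
  exact hpC

theorem memLp_four_of_integrable_exp {θ₀ : ℝ} (hθ₀ : 0 < θ₀)
    (h : ∀ θ ∈ Set.Ioo (-θ₀) θ₀, Integrable (fun ω => Real.exp (θ * Y ω)) P) : MemLp Y 4 P := by
  have : (0 : ℝ) ∈ interior (integrableExpSet Y P) :=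
    mem_interior.2 ⟨Set.Ioo (-θ₀) θ₀, fun θ hθ => h θ hθ, isOpen_Ioo, by simpa using hθ₀⟩
  exact_mod_cast memLp_of_mem_interior_integrableExpSet this 4

end ExponentialMoments

theorem integral_sub_pow_four_le {Ω : Type*} [MeasurableSpace Ω] {P : Measure Ω}
    [IsProbabilityMeasure P] {Y : Ω → ℝ} (hY : MemLp Y 4 P) {m : ℝ} (μ : ℝ) (hμ : |μ| ≤ m) :
    ∫ ω, (Y ω - μ) ^ 4 ∂P ≤ 8 * (∫ ω, |Y ω| ^ 4 ∂P + m ^ 4) := by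
  have hY' : MemLp Y (4 : ℕ) P := hY
  have i4 : Integrable (fun ω => |Y ω| ^ 4) P :=
    (hY'.integrable_pow_of_le le_rfl).congr
      (.of_forall fun ω => (Even.pow_abs (by decide : Even 4) (Y ω)).symm)
  have i4' : Integrable (fun ω => (Y ω - μ) ^ 4) P :=
    (hY'.sub (memLp_const μ)).integrable_pow_of_le le_rfl
  have hm : μ ^ 4 ≤ m ^ 4 := by
    rw [← Even.pow_abs (by decide : Even 4) μ]
    gcongr
  have key : ∀ ω, (Y ω - μ) ^ 4 ≤ 8 * (|Y ω| ^ 4 + m ^ 4) := fun ω => by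
    rw [Even.pow_abs (by decide : Even 4) (Y ω)]
    have h1 : (Y ω - μ) ^ 2 ≤ 2 * (Y ω ^ 2 + μ ^ 2) := by nlinarith [sq_nonneg (Y ω + μ)]
    have h2 : ((Y ω - μ) ^ 2) ^ 2 ≤ (2 * (Y ω ^ 2 + μ ^ 2)) ^ 2 := by gcongr
    nlinarith [sq_nonneg (Y ω ^ 2 - μ ^ 2)]
  refine (integral_mono i4' ((i4.add (integrable_const _)).const_mul 8) key).trans ?_
  rw [integral_const_mul]
  simp only [Pi.add_apply]
  rw [integral_add i4 (integrable_const _)]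
  simp

/-- Integrate `((Y - μ)² - v)² ≥ 0`, with `v` the mean of `(Y - μ)²`. -/
theorem sq_integral_sub_sq_le {Ω : Type*} [MeasurableSpace Ω] {P : Measure Ω}
    [IsProbabilityMeasure P] {Y : Ω → ℝ} (hY : MemLp Y 4 P) (μ : ℝ) :
    (∫ ω, (Y ω - μ) ^ 2 ∂P) ^ 2 ≤ ∫ ω, (Y ω - μ) ^ 4 ∂P := by
  have hY' : MemLp Y (4 : ℕ) P := hY
  have hZ := hY'.sub (memLp_const μ)
  have i2 : Integrable (fun ω => (Y ω - μ) ^ 2) P := hZ.integrable_pow_of_le (by norm_num)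
  have i4 : Integrable (fun ω => (Y ω - μ) ^ 4) P := hZ.integrable_pow_of_le le_rfl
  set v := ∫ ω, (Y ω - μ) ^ 2 ∂P with hv
  have h := integral_mono ((i2.const_mul (2 * v)).sub (integrable_const (v ^ 2))) i4 fun ω =>
    show 2 * v * (Y ω - μ) ^ 2 - v ^ 2 ≤ (Y ω - μ) ^ 4 by
      nlinarith [sq_nonneg ((Y ω - μ) ^ 2 - v)]
  simp only [Pi.sub_apply] at h
  rw [integral_sub (i2.const_mul _) (integrable_const _), integral_const_mul, ← hv] at h
  simp only [integral_const, probReal_univ, one_smul] at h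
  nlinarith

/-! ### Choice of constants and of the time scale -/

/-- The bound for a single walk, with a constant depending only on an exponential moment bound and
a lower bound on the variance of the steps. -/
theorem exists_measure_runningMax_le {C s θ : ℝ} (hC : 0 < C) (hs : 0 < s) (hθ : 0 < θ) :
    ∃ C₀ : ℝ, ∀ (Ω : Type u) [MeasurableSpace Ω] (P : Measure Ω) [IsProbabilityMeasure P]
      (X : ℕ → Ω → ℝ), IsIIDSequence P X → MemLp (X 0) 4 P →
      Integrable (fun ω => Real.exp (θ * X 0 ω)) P →
      Integrable (fun ω => Real.exp (-θ * X 0 ω)) P →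
      mgf (X 0) P θ ≤ C → mgf (X 0) P (-θ) ≤ C → s ≤ Var[X 0; P] → ∫ ω, X 0 ω ∂P ≤ 0 →
      ∀ N : ℕ+, 3 ≤ N → ∀ x : ℝ, 1 ≤ x →
        P.real {ω | runningMax X N ω ≤ x} ≤
          C₀ * x * Real.log (N : ℝ) * max |∫ ω, X 0 ω ∂P| ((N : ℝ) ^ (-(1 / 2) : ℝ)) := by
  set m : ℝ := 2 * C / θ with hm
  set κ : ℝ := 8 * (2 * C * (4 : ℕ).factorial / θ ^ 4 + m ^ 4) with hκdef
  have hκ0 : 0 < κ := by positivity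
  -- This `α` makes the fourth moment loss `3 κ / (8 α³)` equal to `s / (8 α)`, half of the gain `s
  -- / (4 α)`; the other half is `c`.
  set α : ℝ := √(3 * κ / s) with hα
  have hα0 : 0 < α := Real.sqrt_pos.2 (by positivity)
  have hα2 : α ^ 2 = 3 * κ / s := Real.sq_sqrt (by positivity)
  set c : ℝ := s / (8 * α) with hcdef
  have hc : 0 < c := by positivity
  set c' : ℝ := min (c / 4) 1 with hc'def
  have hc' : 0 < c' := lt_min (by positivity) one_pos
  set D : ℝ := 1 + 1 / θ + m + C / θ with hD
  have hm0 : 0 < m := by positivity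
  have hD0 : 0 < D := by positivity
  -- The first summand serves the degenerate case `n = 0`, the second the main case.
  refine ⟨1 / c' + 4 * D / (c * c'), fun Ω _ P _ X hX hL hp hn hpC hnC hvar hmean N hN x hx => ?_⟩
  set μ := ∫ ω, X 0 ω ∂P with hμ
  have hLi : ∀ i, MemLp (X i) 4 P := fun i => (hX.identDistrib i).symm.memLp_snd hL
  have hμi : ∀ i, ∫ ω, X i ω ∂P = μ := fun i => (hX.identDistrib i).integral_eq
  have hμm : |μ| ≤ m := by
    have := integral_abs_pow_le_of_mgf_le hθ hp hn hpC hnC 1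
    simp only [pow_one, Nat.factorial_one, Nat.cast_one, mul_one] at this
    exact (abs_integral_le_integral_abs).trans this
  have hv : ∀ i, ∫ ω, (X i ω - μ) ^ 2 ∂P = ∫ ω, (X 0 ω - μ) ^ 2 ∂P := fun i =>
    ((hX.identDistrib i).comp (measurable_id.sub_const μ |>.pow_const 2)).integral_eq
  have hκ : ∀ i, ∫ ω, (X i ω - μ) ^ 4 ∂P ≤ κ := fun i => by
    refine (((hX.identDistrib i).comp
      (measurable_id.sub_const μ |>.pow_const 4)).integral_eq).le.trans ?_
    refine (integral_sub_pow_four_le hL μ hμm).trans ?_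
    have := integral_abs_pow_le_of_mgf_le hθ hp hn hpC hnC 4
    rw [hκdef]
    linarith
  have hvκ := (sq_integral_sub_sq_le hL μ).trans (hκ 0)
  have hsv : s ≤ ∫ ω, (X 0 ω - μ) ^ 2 ∂P := by
    rwa [variance_eq_integral (hX.measurable 0).aemeasurable] at hvar
  have hcv : c ≤ (∫ ω, (X 0 ω - μ) ^ 2 ∂P) / (4 * α) - 3 * κ / (8 * α ^ 3) := by
    have e : 3 * κ / (8 * α ^ 3) = s / (8 * α) := by
      have : 3 * κ = s * α ^ 2 := by rw [hα2]; field_simp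
      rw [this]; field_simp
    have e2 : s / (4 * α) = 2 * (s / (8 * α)) := by field_simp; norm_num
    have : s / (4 * α) ≤ (∫ ω, (X 0 ω - μ) ^ 2 ∂P) / (4 * α) := by gcongr
    rw [e]
    linarith
  have hN3 : (3 : ℝ) ≤ N := by exact_mod_cast hN
  have hN0 : (0 : ℝ) < N := by linarith
  have hlog : 1 ≤ Real.log N := by
    rw [Real.le_log_iff_exp_le hN0]
    linarith [Real.exp_one_lt_d9]
  set b := max |μ| ((N : ℝ) ^ (-(1 / 2) : ℝ)) with hb
  have hNb : (N : ℝ) ^ (-(1 / 2) : ℝ) ≤ b := le_max_right _ _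
  have hb0 : 0 < b := (Real.rpow_pos_of_pos hN0 _).trans_le hNb
  have hNbb : 1 / b ^ 2 ≤ N := by
    have h1 : ((N : ℝ) ^ (-(1 / 2) : ℝ)) ^ 2 = (N : ℝ)⁻¹ := by
      rw [← Real.rpow_natCast, ← Real.rpow_mul hN0.le, ← Real.rpow_neg_one]
      norm_num
    have h2 : (N : ℝ)⁻¹ ≤ b ^ 2 := by rw [← h1]; gcongr
    rw [one_div]
    exact inv_le_of_inv_le₀ hN0 h2
  -- The time scale: `c' ≤ c / 4` gives `|μ| √n ≤ c / 4`, while `c' ≤ 1` and `b ≥ N^{-1/2}` give `n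
  -- ≤ N`.
  set n := ⌊(c' / b) ^ 2⌋₊ with hndef
  have hnle : (n : ℝ) ≤ (c' / b) ^ 2 := Nat.floor_le (by positivity)
  have hnN : n ≤ N := by
    have h1 : (c' / b) ^ 2 ≤ 1 / b ^ 2 := by
      rw [div_pow]
      gcongr
      exact pow_le_one₀ hc'.le (min_le_right _ _)
    exact_mod_cast (hnle.trans h1).trans hNbb
  have hsn : √(n : ℝ) ≤ c' / b := Real.sqrt_le_iff.2 ⟨by positivity, hnle⟩
  have hxl : x ≤ x * Real.log N := le_mul_of_one_le_right (by linarith) hlog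
  rcases Nat.eq_zero_or_pos n with h0 | h1
  · have h2 : (c' / b) ^ 2 < 1 := Nat.floor_eq_zero.1 h0
    have h3 : c' / b < 1 := by
      by_contra! h
      exact absurd h2 (not_lt.2 (one_le_pow₀ h))
    have h4 : c' ≤ b := ((div_lt_one hb0).1 h3).le
    have h5 : 1 ≤ 1 / c' * b := by
      rw [div_mul_eq_mul_div, one_mul]
      exact (one_le_div hc').2 h4
    refine measureReal_le_one.trans (h5.trans ?_)
    have h6 : 1 / c' ≤ (1 / c' + 4 * D / (c * c')) * (x * Real.log N) := by
      have : 1 ≤ x * Real.log N := hx.trans hxl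
      have h7 : (0 : ℝ) ≤ 4 * D / (c * c') := by positivity
      have h8 : (0 : ℝ) < 1 / c' := by positivity
      nlinarith
    calc 1 / c' * b ≤ (1 / c' + 4 * D / (c * c')) * (x * Real.log N) * b := by gcongr
      _ = _ := by ring
  · have hsub := (setOf_runningMax_le_subset X (by linarith : 0 ≤ x) N).trans
      (belowUntil_anti X x hnN)
    refine (measureReal_mono hsub).trans ?_
    have hnμ : 4 * (|μ| * √(n : ℝ)) ≤ c := by
      have h2 : |μ| * √(n : ℝ) ≤ b * (c' / b) :=
        mul_le_mul (le_max_left _ _) hsn (Real.sqrt_nonneg _) hb0.le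
      rw [mul_div_cancel₀ _ hb0.ne'] at h2
      have := min_le_left (c / 4) 1
      linarith
    have hδ : ∀ i, ∫ ω, max (X i ω - Real.log N / θ) 0 ∂P ≤ (N : ℝ)⁻¹ * C / θ := fun i => by
      have h2 := integral_max_sub_le_of_mgf_le hθ hp hpC (Real.log N / θ)
      rw [mul_div_cancel₀ _ hθ.ne', Real.exp_neg, Real.exp_log hN0] at h2
      exact (((hX.identDistrib i).comp
        ((measurable_id.sub_const (Real.log N / θ)).max
          (measurable_const (a := (0 : ℝ))))).integral_eq).le.trans h2
    have hnδ : n * ((N : ℝ)⁻¹ * C / θ) ≤ C / θ := by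
      have h2 : (n : ℝ) / N ≤ 1 := (div_le_one hN0).2 (by exact_mod_cast hnN)
      calc n * ((N : ℝ)⁻¹ * C / θ) = (n : ℝ) / N * (C / θ) := by ring
        _ ≤ 1 * (C / θ) := by gcongr
        _ = _ := one_mul _
    have key := sqrt_mul_measure_belowUntil_le hX.measurable hX.indep hLi hμi hmean hv hκ hvκ hα0
      hc hcv (by linarith : 0 ≤ x) (by positivity : 0 ≤ Real.log N / θ) hδ hnδ hnμ h1 le_rfl
    have hR : x + Real.log N / θ + |μ| + C / θ ≤ D * (x * Real.log N) := by
      have h2 : Real.log N ≤ x * Real.log N := le_mul_of_one_le_left (by linarith) hx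
      have h3 : 1 ≤ x * Real.log N := hx.trans hxl
      have h4 : Real.log N / θ ≤ 1 / θ * (x * Real.log N) := by
        rw [div_eq_mul_one_div, mul_comm]; gcongr
      have h5 : m ≤ m * (x * Real.log N) := le_mul_of_one_le_right hm0.le h3
      have h6 : C / θ ≤ C / θ * (x * Real.log N) := le_mul_of_one_le_right (by positivity) h3
      rw [hD]
      linarith
    -- Rounding down costs a bounded factor: `(c' / b)² < n + 1 ≤ 4 n` as `n ≥ 1`.
    have hn1 : c' / b ≤ 2 * √(n : ℝ) := by
      have h2 : (c' / b) ^ 2 < n + 1 := Nat.lt_floor_add_one _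
      have h3 : (1 : ℝ) ≤ n := by exact_mod_cast h1
      refine le_of_sq_le_sq ?_ (by positivity)
      rw [mul_pow, Real.sq_sqrt (by positivity)]
      linarith
    have hpos : (0 : ℝ) ≤ P.real (belowUntil X x n) := measureReal_nonneg
    have h7 : c' / b * P.real (belowUntil X x n) ≤ 2 * (2 * (D * (x * Real.log N)) / c) := by
      calc c' / b * P.real (belowUntil X x n) ≤ 2 * √(n : ℝ) * P.real (belowUntil X x n) := by
            gcongr
        _ = 2 * (√(n : ℝ) * P.real (belowUntil X x n)) := by ring
        _ ≤ 2 * (2 * (x + Real.log N / θ + |μ| + C / θ) / c) := by gcongr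
        _ ≤ _ := by gcongr
    have h8 : P.real (belowUntil X x n) ≤ 4 * D / (c * c') * (x * Real.log N) * b := by
      calc P.real (belowUntil X x n) = c' / b * P.real (belowUntil X x n) * (b / c') := by
            field_simp
        _ ≤ 2 * (2 * (D * (x * Real.log N)) / c) * (b / c') := by gcongr
        _ = _ := by field_simp; ring
    have h9 : 0 ≤ 1 / c' * (x * Real.log N) * b := by positivity
    linarith

/-! ### Uniformity over compact parameter sets -/

theorem IsCompact.exists_pos_forall_le {α : Type*} [TopologicalSpace α] {K : Set α}
    (hK : IsCompact K) {f : α → ℝ} (hf : Continuous f) (hpos : ∀ a ∈ K, 0 < f a) :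
    ∃ r, 0 < r ∧ ∀ a ∈ K, r ≤ f a := by
  rcases K.eq_empty_or_nonempty with rfl | hne
  · exact ⟨1, one_pos, by simp⟩
  · obtain ⟨a, ha, h⟩ := hK.exists_isMinOn hne hf.continuousOn
    exact ⟨f a, hpos a ha, fun b hb => h hb⟩

theorem corollary2p4 (K : Set (ℝ × ℝ × ℝ × ℝ)) (hK : IsCompact K)
    (hpos : ∀ CM cμ σsq θ₁ : ℝ, (CM, cμ, σsq, θ₁) ∈ K → 0 < CM ∧ 0 < cμ ∧ 0 < σsq ∧ 0 < θ₁) :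
    ∃ (C₀ : ℝ) (N₀ : ℕ+),
      ∀ CM cμ σsq θ₁ : ℝ, (CM, cμ, σsq, θ₁) ∈ K →
      ∀ (Ω : ℕ+ → Type u) [∀ N, MeasurableSpace (Ω N)] (P : ∀ N, Measure (Ω N))
        [∀ N, IsProbabilityMeasure (P N)] (X : ∀ N, ℕ → Ω N → ℝ),
      SmallDriftAssumption CM cμ σsq θ₁ Ω P X →
      ∀ N : ℕ+, N₀ ≤ N → ∀ x : ℝ, (Real.log (N : ℝ)) ^ 2 ≤ x →
        (P N).real {ω | runningMax (X N) N ω ≤ x} ≤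
          C₀ * x * Real.log (N : ℝ) *
            max |∫ ω, X N 0 ω ∂(P N)| ((N : ℝ) ^ (-(1 / 2) : ℝ)) := by
  obtain ⟨C, hC⟩ := hK.bddAbove_image (f := fun p => p.1) continuous_fst.continuousOn
  obtain ⟨s, hs, hsK⟩ := hK.exists_pos_forall_le (f := fun p => p.2.2.1) (by fun_prop)
    fun p hp => (hpos p.1 p.2.1 p.2.2.1 p.2.2.2 hp).2.2.1
  obtain ⟨θ, hθ, hθK⟩ := hK.exists_pos_forall_le (f := fun p => p.2.2.2) (by fun_prop)
    fun p hp => (hpos p.1 p.2.1 p.2.2.1 p.2.2.2 hp).2.2.2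
  -- The maximum with `1` keeps the constant positive even if `K` is empty and `C` is arbitrary.
  obtain ⟨C₀, h⟩ := exists_measure_runningMax_le.{u} (C := max C 1) (by positivity) hs hθ
  -- Since `e < 3`, `N ≥ 3` gives `log N ≥ 1`, whence `x ≥ (log N)² ≥ 1`.
  refine ⟨C₀, 3, fun CM cμ σsq θ₁ hmem Ω _ P _ X hA N hN x hx => ?_⟩
  obtain ⟨θ₀, hθ₀, hexp⟩ := hA.mgf_finite
  have hθ₁ : θ ≤ θ₁ := hθK _ hmem
  have hCM : CM ≤ max C 1 := (hC (Set.mem_image_of_mem _ hmem)).trans (le_max_left _ _)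
  have hmgf : ∀ t ∈ Set.Icc (-θ₁) θ₁, mgf (X N 0) (P N) t ≤ max C 1 := fun t ht => by
    have := hA.mgf_bound N 0 (by norm_num) t ht
    rw [iteratedDeriv_zero] at this
    exact (le_abs_self _).trans (this.trans hCM)
  refine h (Ω N) (P N) (X N) (hA.iid N)
    (memLp_four_of_integrable_exp (by linarith) (hexp N))
    (hexp N θ ⟨by linarith, by linarith⟩) (hexp N (-θ) ⟨by linarith, by linarith⟩)
    (hmgf θ ⟨by linarith, by linarith⟩) (hmgf (-θ) ⟨by linarith, by linarith⟩)
    ((hsK _ hmem).trans (hA.variance_lower N)) (hA.mean_nonpos N) N hN x (le_trans ?_ hx)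
  have hN3 : (3 : ℝ) ≤ N := by exact_mod_cast hN
  refine one_le_pow₀ ?_
  rw [Real.le_log_iff_exp_le (by linarith)]
  linarith [Real.exp_one_lt_d9]
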